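/- Let $\lambda=\lambda^{<\lambda}$ and $\mu=\mu^{\lambda}$ be regular (infinite) cardinals, and let $K\subseteq[\lambda,\mu]$ be a set of regular cardinals with $\lambda,\mu\in K$. For $\kappa\in K$ let $E_\kappa$ be the equivalence relation on $\mu$ given by $i\mathrel{E_\kappa}j$ iff $i+\kappa=j+\kappa$ (ordinal addition), let $[i]_\kappa$ be the $E_\kappa$-class of $i$, let $A/E_\kappa=\{[i]_\kappa: i\in A\}$ for $A\subseteq\mu$, and let $\theta_\kappa$ be the least regular cardinal $\ge\sup((K\cap\kappa)\cup\{\lambda\})$. A class $C\in\mu/E_\kappa$ *grows* from $A$ to $B$ iff $\emptyset\ne C\cap A\ne C\cap B$. Let $\mathbf Q=(Q,\le)$ be the forcing notion (larger conditions are stronger) whose conditions are the partial functions $q$ from $\mu$ to $\{0,1\}$ such that $|[i]_\kappa\cap\operatorname{dom}q|<\theta_\kappa$ for all $i<\mu$ and $\kappa\in K$, where $p\le q$ iff $p\subseteq q$ and, for every $\kappa\in K$, fewer than $\theta_\kappa$ classes of $E_\kappa$ grow from $\operatorname{dom}p$ to $\operatorname{dom}q$. For $\kappa\in K$ write $p\le^{pr}_\kappa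 q$ iff $p\le q$ and no $E_\kappa$-class that meets $\operatorname{dom}p$ grows from $\operatorname{dom}p$ to $\operatorname{dom}q$, and write $p\le^{apr}_\kappa q$ iff $p\le q$ and $(\operatorname{dom}q)/E_\kappa=(\operatorname{dom}p)/E_\kappa$. **Lemma.** Let $\kappa\in K$ with $2^{<\theta_\kappa}<\kappa$, let $p\in Q$, and let $\dot\alpha$ be a $\mathbf Q$-name with $p\Vdash_{\mathbf Q}$ "$\dot\alpha$ is an ordinal". Then there are $q\in Q$ and a sequence $(r_i: i<i^*)$ of conditions in $Q$, indexed by an ordinal $i^*$, such that: (a) $i^*<(2^{<\theta_\kappa})^+$; (b) $p\le^{pr}_\kappa q$; (c) $q\le^{apr}_\kappa r_i$ for all $i<i^*$; (d) for every $i<i^*$ there is an ordinal $\alpha_i$ such that $r_i\Vdash_{\mathbf Q}\dot\alpha=\check\alpha_i$; (e) $\{r_i: i<i^*\}$ is predense above $q$, that is, every $s\ge q$ in $Q$ has a common extension in $\mathbf Q$ with some $r_i$. -/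

import Mathlib

universe u

open Cardinal Order

namespace PolarizedForcing

/-! ## Forcing: names and the forcing relation

Larger conditions are stronger; `⊥` is the weakest (empty) condition.  The ground model is the
universe `Type u`. -/

/-- `P`-names: a name is a (small) set of pairs consisting of a name `elt i` and a condition
`cond i`. -/
inductive PName (P : Type u) : Type (u + 1)
  | mk (ι : Type u) (elt : ι → PName P) (cond : ι → P) : PName P

/-- `ForcesEq p x y` is `p ⊩ x = y`: whenever `(x', c) ∈ x`, it is dense above every common
extension of `p` and `c` to force that `x'` equals an element of `y` that is present, and
symmetrically. -/
def ForcesEq {P : Type u} [LE P] (p : P) : PName P → PName P → Prop :=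
  fun x y => go x y p
where
  /-- The recursion on names behind `ForcesEq`. -/
  go : PName P → PName P → P → Prop
  | .mk ι A c, .mk κ B d => fun p =>
      (∀ (i : ι) (q : P), p ≤ q → c i ≤ q →
        ∃ r, q ≤ r ∧ ∃ j : κ, d j ≤ r ∧ go (A i) (B j) r) ∧
      (∀ (j : κ) (q : P), p ≤ q → d j ≤ q →
        ∃ r, q ≤ r ∧ ∃ i : ι, c i ≤ r ∧ go (A i) (B j) r)

/-- `ForcesMem p x y` is `p ⊩ x ∈ y`: the conditions `r` such that, for some `(y', d) ∈ y`,
`d ≤ r` and `r ⊩ x = y'` are dense above `p`. -/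
def ForcesMem {P : Type u} [LE P] (p : P) (x : PName P) : PName P → Prop
  | .mk κ B d => ∀ q, p ≤ q → ∃ r, q ≤ r ∧ ∃ j : κ, d j ≤ r ∧ ForcesEq r x (B j)

/-- `ForcesOrdinal p x` is `p ⊩ "x is an ordinal"`, that is, `p` forces that `x` is a transitive
set on which membership is transitive:
`(∀ y z, z ∈ y → y ∈ x → z ∈ x) ∧ (∀ y z w, y ∈ z → z ∈ w → w ∈ x → y ∈ w)`
(the same definition as `ZFSet.IsOrdinal`).  As usual, `p ⊩ ∀ y, φ y` iff `p ⊩ φ y` for every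
name `y`, and `p ⊩ φ → ψ` iff every extension of `p` that forces `φ` forces `ψ`. -/
def ForcesOrdinal {P : Type u} [LE P] (p : P) (x : PName P) : Prop :=
  (∀ y z : PName P, ∀ q, p ≤ q → ForcesMem q z y → ForcesMem q y x → ForcesMem q z x) ∧
  (∀ y z w : PName P, ∀ q, p ≤ q →
    ForcesMem q y z → ForcesMem q z w → ForcesMem q w x → ForcesMem q y w)

/-- The canonical name of the (von Neumann) ordinal `a` of the ground model: the set of all pairs
`(ordName b, ⊥)` with `b < a`. -/
noncomputable def ordName (P : Type u) [LE P] [OrderBot P] (a : Ordinal.{u}) : PName P :=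
  PName.mk a.ToType (fun i => ordName P (i.toOrd : Ordinal.{u})) (fun _ => ⊥)
termination_by a
decreasing_by exact i.toOrd.2

/-- `p ⊩ x = a` for some ordinal `a` of the ground model. -/
def Decides {P : Type u} [LE P] [OrderBot P] (p : P) (x : PName P) : Prop :=
  ∃ a : Ordinal.{u}, ForcesEq p x (ordName P a)

/-- `p` and `q` have a common extension. -/
def Compatible {P : Type u} [LE P] (p q : P) : Prop := ∃ r, p ≤ r ∧ q ≤ r

/-- Every extension of `q` is compatible with a member of `R`. -/
def PredenseAbove {P : Type u} [LE P] (R : Set P) (q : P) : Prop :=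
  ∀ s, q ≤ s → ∃ r ∈ R, Compatible r s

/-! ## The forcing `Q_K` -/

/-- `θ_κ`: the least regular cardinal `≥ ⋃ ((K ∩ κ) ∪ {λ})`. -/
noncomputable def theta (lam : Cardinal.{u}) (K : Set Cardinal.{u}) (kap : Cardinal.{u}) :
    Cardinal.{u} :=
  sInf {c | c.IsRegular ∧ sSup ((K ∩ Set.Iio kap) ∪ {lam}) ≤ c}

theorem theta_isRegular (lam : Cardinal.{u}) (K : Set Cardinal.{u}) (kap : Cardinal.{u}) :
    (theta lam K kap).IsRegular := by
  have h : {c : Cardinal.{u} | c.IsRegular ∧ sSup ((K ∩ Set.Iio kap) ∪ {lam}) ≤ c}.Nonempty :=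
    ⟨succ (max ℵ₀ (sSup ((K ∩ Set.Iio kap) ∪ {lam}))), isRegular_succ (le_max_left _ _),
      (le_max_right _ _).trans (le_succ _)⟩
  exact (csInf_mem h).1

/-- The set of ordinals `< μ`. -/
abbrev Pt (mu : Cardinal.{u}) : Type u := mu.ord.ToType

/-- `[i]_κ`, the class of `i < μ` under `i E_κ j ↔ i + κ = j + κ` (ordinal addition). -/
def cls {mu : Cardinal.{u}} (kap : Cardinal.{u}) (i : Pt mu) : Set (Pt mu) :=
  {j | (i.toOrd : Ordinal.{u}) + kap.ord = (j.toOrd : Ordinal.{u}) + kap.ord}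

/-- `S / E_κ = {[i]_κ : i ∈ S}`. -/
def classes {mu : Cardinal.{u}} (kap : Cardinal.{u}) (S : Set (Pt mu)) : Set (Set (Pt mu)) :=
  cls kap '' S

/-- `A` grows from `S` to `T`. -/
def Grows {X : Type u} (A S T : Set X) : Prop := (A ∩ S).Nonempty ∧ A ∩ S ≠ A ∩ T

/-- The set `{A ∈ μ / E_κ : A grows from S to T}`. -/
def growing {mu : Cardinal.{u}} (kap : Cardinal.{u}) (S T : Set (Pt mu)) : Set (Set (Pt mu)) :=
  {A ∈ classes kap Set.univ | Grows A S T}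

/-- The domain of a partial function from `μ` to `{0, 1}`, given as a function to
`Option Bool` with value `none` off the domain. -/
def pdom {X : Type u} (f : X → Option Bool) : Set X := {i | f i ≠ none}

/-- The conditions: partial functions `q` from `μ` to `{0, 1}` with
`card ([i]_κ ∩ dom q) < θ_κ` for all `i < μ` and `κ ∈ K`. -/
structure Cond (lam mu : Cardinal.{u}) (K : Set Cardinal.{u}) : Type u where
  /-- The partial function. -/
  toFun : Pt mu → Option Bool
  small : ∀ (i : Pt mu), ∀ kap ∈ K,
    #(cls kap i ∩ pdom toFun : Set (Pt mu)) < theta lam K kap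

variable {lam mu : Cardinal.{u}} {K : Set Cardinal.{u}}

/-- The domain of a condition. -/
def Cond.dom (p : Cond lam mu K) : Set (Pt mu) := pdom p.toFun

/-- `p ≤ q` iff `q` extends `p` as a partial function and, for every `κ ∈ K`, fewer than `θ_κ`
classes of `E_κ` grow from `dom p` to `dom q`. -/
instance : LE (Cond lam mu K) where
  le p q := (∀ i b, p.toFun i = some b → q.toFun i = some b) ∧
    ∀ kap ∈ K, #(growing kap p.dom q.dom) < theta lam K kap

theorem Cond.dom_mono {p q : Cond lam mu K} (h : p ≤ q) : p.dom ⊆ q.dom := by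
  intro i hi
  obtain ⟨b, hb⟩ := Option.ne_none_iff_exists'.1 hi
  exact Option.ne_none_iff_exists'.2 ⟨b, h.1 i b hb⟩

instance : PartialOrder (Cond lam mu K) where
  le_refl p := ⟨fun _ _ h => h, fun kap _ => by
    have : growing kap p.dom p.dom = ∅ := by
      ext A; simp [growing, Grows]
    rw [this, mk_eq_zero]
    exact (theta_isRegular lam K kap).pos⟩
  le_trans p q r hpq hqr := ⟨fun i b h => hqr.1 i b (hpq.1 i b h), fun kap hk => by
    have hsub : growing kap p.dom r.dom ⊆ growing kap p.dom q.dom ∪ growing kap q.dom r.dom := by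
      rintro A ⟨hA, hne, hgr⟩
      by_cases h : A ∩ p.dom = A ∩ q.dom
      · exact Or.inr ⟨hA, h ▸ hne, h ▸ hgr⟩
      · exact Or.inl ⟨hA, hne, h⟩
    exact (mk_le_mk_of_subset hsub).trans_lt ((mk_union_le _ _).trans_lt
      (add_lt_of_lt (theta_isRegular lam K kap).aleph0_le (hpq.2 kap hk) (hqr.2 kap hk)))⟩
  le_antisymm p q hpq hqp := by
    obtain ⟨f, hf⟩ := p
    obtain ⟨g, hg⟩ := q
    have : f = g := by
      funext i
      exact Option.ext fun b => ⟨hpq.1 i b, hqp.1 i b⟩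
    subst this
    rfl

/-- The empty condition is the weakest one. -/
instance : OrderBot (Cond lam mu K) where
  bot := ⟨fun _ => none, fun i kap _ => by
    have : cls kap i ∩ pdom (fun _ : Pt mu => (none : Option Bool)) = ∅ := by
      ext j; simp [pdom]
    rw [this, mk_eq_zero]
    exact (theta_isRegular lam K kap).pos⟩
  bot_le p := ⟨fun _ _ h => by simp at h, fun kap _ => by
    have : growing kap (pdom (fun _ : Pt mu => (none : Option Bool))) p.dom = ∅ := by
      ext A; simp [growing, Grows, pdom]
    change #(growing kap (pdom (fun _ : Pt mu => (none : Option Bool))) p.dom) < _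
    rw [this, mk_eq_zero]
    exact (theta_isRegular lam K kap).pos⟩

/-- `p ≤^{pr}_κ q`: `p ≤ q` and no class of `E_κ` represented in `dom p` grows from `dom p` to
`dom q`. -/
def PureLE (kap : Cardinal.{u}) (p q : Cond lam mu K) : Prop :=
  p ≤ q ∧ ∀ A ∈ classes kap p.dom, ¬ Grows A p.dom q.dom

/-- `p ≤^{apr}_κ q`: `p ≤ q` and `dom q / E_κ = dom p / E_κ`. -/
def ApureLE (kap : Cardinal.{u}) (p q : Cond lam mu K) : Prop :=
  p ≤ q ∧ classes kap q.dom = classes kap p.dom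

end PolarizedForcing

/-! The set `D` of conditions deciding the name is open, and dense above `p`. Write θ for `theta lam
K kap`. Consider pairs `(q, V)`, where `q` is a pure extension of `p` and `V` consists of
differences `r ∖ q` of apure extensions `r ∈ D` of `q`, no two of which agree in the sense of
`Agree` for the E_θ-classes. Three facts carry the argument.

Amalgamation: if `q'` purely extends `q` and `r` apurely extends `q`, then `q' ∪ r` is a common
extension, apure over `q'` and with the same difference, so `V` survives the passage to `q'`.

Chain condition (`mk_le_of_pairwise_not_agree`): differences have size `< θ` and E_θ-classes have
size at most θ, so `V` has at most `2^{<θ}` members.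

Closure (`PureLE.exists_upperBound`): chains of fewer than `kap` pure extensions have pure upper
bounds.

Since `2^{<θ} < kap`, Zorn's lemma yields a pair whose `V` cannot grow. Given `s ≥ q`, extend it to
`t ∈ D` and factor `q ≤ t` as a pure step to some `q'` and an apure step. By maximality `t ∖ q'`
agrees with some `r ∖ q` in `V`, and this makes `q' ∪ r` compatible with `t`. Hence the conditions
`r` are predense above `q`. -/

namespace PolarizedForcing

/-! ### Forcing equality, and deciding names of ordinals. -/

section Names

variable {P : Type u}

/-- The rank of a name. -/
noncomputable def PName.rank : PName P → Ordinal.{u}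
  | .mk _ A _ => ⨆ i, succ (A i).rank

theorem PName.rank_lt {ι : Type u} (A : ι → PName P) (c : ι → P) (i : ι) :
    (A i).rank < (PName.mk ι A c).rank := by
  rw [PName.rank]
  exact (lt_succ _).trans_le (Ordinal.le_iSup (fun i => succ (A i).rank) i)

variable [PartialOrder P]

theorem forcesEq_mk {p : P} {ι κ : Type u} {A : ι → PName P} {c : ι → P} {B : κ → PName P}
    {d : κ → P} : ForcesEq p (.mk ι A c) (.mk κ B d) ↔
      (∀ (i : ι) (q : P), p ≤ q → c i ≤ q →
        ∃ r, q ≤ r ∧ ∃ j : κ, d j ≤ r ∧ ForcesEq r (A i) (B j)) ∧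
      (∀ (j : κ) (q : P), p ≤ q → d j ≤ q →
        ∃ r, q ≤ r ∧ ∃ i : ι, c i ≤ r ∧ ForcesEq r (A i) (B j)) := by
  simp only [ForcesEq, ForcesEq.go]

theorem ForcesEq.refl (x : PName P) : ∀ p : P, ForcesEq p x x := by
  induction x with
  | mk ι A c ih =>
    intro p
    rw [forcesEq_mk]
    exact ⟨fun i q _ hc => ⟨q, le_rfl, i, hc, ih i q⟩, fun i q _ hc => ⟨q, le_rfl, i, hc, ih i q⟩⟩

theorem ForcesEq.symm {x y : PName P} {p : P} (h : ForcesEq p x y) : ForcesEq p y x := by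
  induction x generalizing y p with
  | mk ι A c ih =>
    obtain ⟨κ, B, d⟩ := y
    rw [forcesEq_mk] at h ⊢
    refine ⟨fun j q hq hd => ?_, fun i q hq hc => ?_⟩
    · obtain ⟨r, hr, i, hi, he⟩ := h.2 j q hq hd
      exact ⟨r, hr, i, hi, ih i he⟩
    · obtain ⟨r, hr, j, hj, he⟩ := h.1 i q hq hc
      exact ⟨r, hr, j, hj, ih i he⟩

theorem ForcesEq.mono {x y : PName P} {p q : P} (h : ForcesEq p x y) (hpq : p ≤ q) :
    ForcesEq q x y := by
  obtain ⟨ι, A, c⟩ := x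
  obtain ⟨κ, B, d⟩ := y
  rw [forcesEq_mk] at h ⊢
  exact ⟨fun i r hr => h.1 i r (hpq.trans hr), fun j r hr => h.2 j r (hpq.trans hr)⟩

theorem forcesMem_elt {ι : Type u} (A : ι → PName P) (c : ι → P) {i : ι} {p : P} (hp : c i ≤ p) :
    ForcesMem p (A i) (.mk ι A c) :=
  fun q hq => ⟨q, le_rfl, i, hp.trans hq, ForcesEq.refl _ _⟩

theorem ForcesMem.mono {x y : PName P} {p q : P} (h : ForcesMem p x y) (hpq : p ≤ q) :
    ForcesMem q x y := by
  obtain ⟨κ, B, d⟩ := y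
  exact fun r hr => h r (hpq.trans hr)

theorem ForcesOrdinal.mono {x : PName P} {p q : P} (h : ForcesOrdinal p x) (hpq : p ≤ q) :
    ForcesOrdinal q x :=
  ⟨fun y z r hr => h.1 y z r (hpq.trans hr), fun y z w r hr => h.2 y z w r (hpq.trans hr)⟩

theorem ForcesOrdinal.of_mem {x y : PName P} {p : P} (h : ForcesOrdinal p x)
    (hy : ForcesMem p y x) : ForcesOrdinal p y :=
  ⟨fun z w q hq hwz hzy => h.2 w z y q hq hwz hzy (hy.mono hq),
    fun z w v q hq hzw hwv hvy => h.2 z w v q hq hzw hwv (h.1 y v q hq hvy (hy.mono hq))⟩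

variable [OrderBot P]

theorem ordName_eq (a : Ordinal.{u}) : ordName P a =
    PName.mk a.ToType (fun i => ordName P (i.toOrd : Ordinal.{u})) (fun _ => ⊥) := by
  rw [ordName]

theorem forcesEq_mk_ordName {p : P} {ι : Type u} {A : ι → PName P} {c : ι → P} {a : Ordinal.{u}} :
    ForcesEq p (.mk ι A c) (ordName P a) ↔
      (∀ (i : ι) (q : P), p ≤ q → c i ≤ q → ∃ r, q ≤ r ∧ ∃ b < a, ForcesEq r (A i) (ordName P b)) ∧
      (∀ b < a, ∀ q : P, p ≤ q → ∃ r, q ≤ r ∧ ∃ i : ι, c i ≤ r ∧ ForcesEq r (A i) (ordName P b)) := by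
  rw [ordName_eq, forcesEq_mk]
  refine and_congr ?_ ?_
  · refine forall_congr' fun i => forall_congr' fun q => imp_congr_right fun _ =>
      imp_congr_right fun _ => exists_congr fun r => and_congr_right fun _ => ?_
    constructor
    · rintro ⟨j, -, h⟩
      exact ⟨_, j.toOrd.2, h⟩
    · rintro ⟨b, hb, h⟩
      exact ⟨Ordinal.ToType.mk ⟨b, hb⟩, bot_le, by simpa using h⟩
  · constructor
    · intro h b hb q hq
      simpa using h (Ordinal.ToType.mk ⟨b, hb⟩) q hq bot_le
    · intro h j q hq _
      exact h _ j.toOrd.2 q hq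

/-- The rank bounds the possible values, so some ordinal is certainly forced not to belong to a
given name. -/
theorem ForcesEq.le_rank {x : PName P} {p : P} {a : Ordinal.{u}}
    (h : ForcesEq p x (ordName P a)) : a ≤ x.rank := by
  induction x generalizing p a with
  | mk ι A c ih =>
    refine le_of_forall_lt fun b hb => ?_
    obtain ⟨r, -, i, -, hr⟩ := (forcesEq_mk_ordName.1 h).2 b hb p le_rfl
    exact (ih i hr).trans_lt (PName.rank_lt A c i)

theorem forcesMem_ordName_mk {p : P} {ι : Type u} {A : ι → PName P} {c : ι → P}
    {a : Ordinal.{u}} : ForcesMem p (ordName P a) (.mk ι A c) ↔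
      ∀ q, p ≤ q → ∃ r, q ≤ r ∧ ∃ i, c i ≤ r ∧ ForcesEq r (A i) (ordName P a) :=
  forall_congr' fun _ => imp_congr_right fun _ => exists_congr fun _ => and_congr_right fun _ =>
    exists_congr fun _ => and_congr_right fun _ => ⟨ForcesEq.symm, ForcesEq.symm⟩

theorem ForcesEq.ordName_mem {x : PName P} {p : P} {a b : Ordinal.{u}}
    (h : ForcesEq p x (ordName P b)) (hab : a < b) : ForcesMem p (ordName P a) x := by
  obtain ⟨ι, A, c⟩ := x
  exact forcesMem_ordName_mk.2 ((forcesEq_mk_ordName.1 h).2 a hab)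

/-- A condition forcing `x` to be an ordinal has an extension deciding which one. -/
theorem ForcesOrdinal.exists_decides {x : PName P} {p : P} (hx : ForcesOrdinal p x) :
    ∃ r, p ≤ r ∧ Decides r x := by
  induction x generalizing p with
  | mk ι A c ih =>
    set x : PName P := .mk ι A c with hxdef
    have hne : ∃ a : Ordinal.{u}, ∃ r, p ≤ r ∧ ∀ s, r ≤ s → ¬ ForcesMem s (ordName P a) x := by
      refine ⟨x.rank, p, le_rfl, fun s _ hs => ?_⟩
      obtain ⟨t, -, i, -, ht⟩ := forcesMem_ordName_mk.1 hs s le_rfl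
      exact (ht.le_rank.trans_lt (PName.rank_lt A c i)).false
    -- Take the least `a` that some extension `r` forces out of `x`; then `r` forces `x = a`. An
    -- element of `x` with value at least `a` would put `a` into `x` by transitivity, and no smaller
    -- ordinal can be forced out.
    obtain ⟨a, ⟨r, hpr, hr⟩, hmin⟩ := WellFounded.has_min Ordinal.lt_wf _ hne
    refine ⟨r, hpr, a, forcesEq_mk_ordName.2 ⟨fun i q hq hc => ?_, fun b hb q hq => ?_⟩⟩
    · have hmem : ForcesMem q (A i) x := forcesMem_elt A c hc
      obtain ⟨s, hqs, b, hb⟩ := ih i ((hx.mono (hpr.trans hq)).of_mem hmem)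
      refine ⟨s, hqs, b, lt_of_not_ge fun hab => hr s (hq.trans hqs) ?_, hb⟩
      rcases hab.eq_or_lt with rfl | hab
      · exact forcesMem_ordName_mk.2 fun t ht => ⟨t, le_rfl, i, hc.trans (hqs.trans ht), hb.mono ht⟩
      · exact hx.1 (A i) _ s (hpr.trans (hq.trans hqs)) (hb.ordName_mem hab) (hmem.mono hqs)
    · have h := fun hb' => hmin b hb' hb
      have : ∃ s, q ≤ s ∧ ForcesMem s (ordName P b) x := by
        by_contra! hcon
        exact h ⟨q, hpr.trans hq, hcon⟩
      obtain ⟨s, hqs, hs⟩ := this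
      obtain ⟨t, hst, ht⟩ := forcesMem_ordName_mk.1 hs s le_rfl
      exact ⟨t, hqs.trans hst, ht⟩

theorem Decides.mono {x : PName P} {p q : P} (h : Decides p x) (hpq : p ≤ q) : Decides q x :=
  h.imp fun _ ha => ha.mono hpq

end Names

/-! ### Cardinal arithmetic of `2^{<θ}` and the chain condition. -/

section Cardinals

theorem mk_iUnion_le_of_le {ι α : Type u} {f : ι → Set α} {c : Cardinal.{u}} (hc : ℵ₀ ≤ c)
    (hι : #ι ≤ c) (hf : ∀ i, #(f i) ≤ c) : #(⋃ i, f i) ≤ c :=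
  (mk_iUnion_le f).trans ((mul_le_mul' hι (ciSup_le' hf)).trans (mul_eq_self hc).le)

theorem mk_biUnion_le_of_le {ι α : Type u} {s : Set ι} {f : ι → Set α} {c : Cardinal.{u}}
    (hc : ℵ₀ ≤ c) (hs : #s ≤ c) (hf : ∀ i ∈ s, #(f i) ≤ c) : #(⋃ i ∈ s, f i) ≤ c := by
  rw [Set.biUnion_eq_iUnion]
  exact mk_iUnion_le_of_le hc hs fun i => hf i i.2

theorem mk_biUnion_lt_of_isRegular {ι α : Type u} {s : Set ι} {f : ι → Set α} {c : Cardinal.{u}}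
    (hc : c.IsRegular) (hs : #s < c) (hf : ∀ i ∈ s, #(f i) < c) : #(⋃ i ∈ s, f i : Set α) < c := by
  rw [Set.biUnion_eq_iUnion]
  exact (card_iUnion_lt_iff_forall_of_isRegular hc hs).2 fun i => hf i i.2

theorem le_two_powerlt (c : Cardinal.{u}) : c ≤ 2 ^< c :=
  le_of_forall_lt fun d hd => (cantor d).trans_le (le_powerlt 2 hd)

theorem lt_powerlt {a b c : Cardinal.{u}} : a < b ^< c ↔ ∃ d < c, a < b ^ d := by
  simpa using (powerlt_le (a := b) (b := c) (c := a)).not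

theorem card_toOrd_lt {c : Cardinal.{u}} (t : c.ord.ToType) : (t.toOrd : Ordinal.{u}).card < c :=
  lt_ord.1 t.toOrd.2

theorem exists_card_toOrd_eq {c d : Cardinal.{u}} (h : d < c) :
    ∃ t : c.ord.ToType, (t.toOrd : Ordinal.{u}).card = d :=
  ⟨Ordinal.ToType.mk ⟨d.ord, ord_lt_ord.2 h⟩, by simp⟩

/-- `(2^{<θ})^c = 2^{<θ}` for `c < θ`, `θ` regular. -/
theorem two_powerlt_power_le {θ c : Cardinal.{u}} (hθ : θ.IsRegular) (hc : c < θ) :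
    (2 ^< θ) ^ c ≤ 2 ^< θ := by
  have hχ : ℵ₀ ≤ 2 ^< θ := hθ.aleph0_le.trans (le_two_powerlt θ)
  by_cases hatt : ∃ d < θ, 2 ^ d = 2 ^< θ
  · obtain ⟨d, hd, he⟩ := hatt
    calc (2 ^< θ) ^ c = 2 ^ (d * c) := by rw [← he, power_mul]
      _ ≤ 2 ^< θ := le_powerlt 2 (mul_lt_of_lt hθ.aleph0_le hd hc)
  push Not at hatt
  have hlt : ∀ d < θ, (2 : Cardinal.{u}) ^ d < 2 ^< θ := fun d hd =>
    (le_powerlt 2 hd).lt_of_ne (hatt d hd)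
  let Y := (2 ^< θ : Cardinal.{u}).ord.ToType
  -- By regularity of θ, the values of a function from `c < θ` into `2^{<θ}` lie below a single
  -- `2^d` with `d < θ`. Hence θ many sets `S t` cover all functions, each of size at most `2^{<θ}`.
  let S : θ.ord.ToType → Set (c.out → Y) := fun t =>
    {f | ∀ i, ((f i).toOrd : Ordinal.{u}) < (2 ^ (t.toOrd : Ordinal.{u}).card : Cardinal.{u}).ord}
  have hS : ∀ t, #(S t) ≤ 2 ^< θ := by
    intro t
    set d := (t.toOrd : Ordinal.{u}).card with hd
    let φ : S t → (c.out → (2 ^ d : Cardinal.{u}).ord.ToType) := fun f i =>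
      Ordinal.ToType.mk ⟨((f.1 i).toOrd : Ordinal.{u}), f.2 i⟩
    have hφ : Function.Injective φ := by
      intro f g h
      ext i
      have h0 : φ f i = φ g i := congrFun h i
      have h1 : ((f.1 i).toOrd : Ordinal.{u}) = (g.1 i).toOrd :=
        Subtype.mk.inj
          ((Ordinal.ToType.mk (o := (2 ^ d : Cardinal.{u}).ord)).injective h0)
      exact Ordinal.ToType.mk.symm.injective (Subtype.ext h1)
    have h1 := mk_le_of_injective hφ
    have h2 : #(c.out → (2 ^ d : Cardinal.{u}).ord.ToType) = 2 ^ (d * c) := by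
      rw [← power_def, mk_ord_toType, mk_out, power_mul]
    rw [h2] at h1
    exact h1.trans (le_powerlt 2 (mul_lt_of_lt hθ.aleph0_le (card_toOrd_lt t) hc))
  have hcov : (⋃ t, S t) = Set.univ := by
    refine Set.eq_univ_of_forall fun f => ?_
    have h1 : ∀ i, ∃ d < θ, ((f i).toOrd : Ordinal.{u}).card < 2 ^ d := fun i =>
      lt_powerlt.1 (card_toOrd_lt (f i))
    choose d hd hfd using h1
    have hsup : (⨆ i, d i) < θ := iSup_lt_of_lt_cof_ord (by rwa [mk_out, hθ.cof_ord]) hd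
    obtain ⟨t, ht⟩ := exists_card_toOrd_eq hsup
    refine Set.mem_iUnion.2 ⟨t, fun i => ?_⟩
    rw [ht, lt_ord]
    exact (hfd i).trans_le (power_le_power_left two_ne_zero (le_ciSup (bddAbove_of_small) i))
  have h := mk_iUnion_le_of_le (f := S) hχ (by rw [mk_ord_toType]; exact le_two_powerlt θ) hS
  rw [hcov, mk_univ, ← power_def, mk_ord_toType, mk_out] at h
  exact h

theorem mk_subsets_lt_le {X : Type u} {θ χ : Cardinal.{u}} (hχ : ℵ₀ ≤ χ) (hθ : θ ≤ χ)
    (hpow : ∀ c < θ, χ ^ c ≤ χ) {J : Set X} (hJ : #J ≤ χ) :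
    #({t | t ⊆ J ∧ #t < θ} : Set (Set X)) ≤ χ := by
  have hsub : {t : Set X | t ⊆ J ∧ #t < θ} ⊆
      ⋃ a : θ.ord.ToType, {t : Set X | t ⊆ J ∧ #t ≤ (a.toOrd : Ordinal.{u}).card} := by
    rintro t ⟨htJ, ht⟩
    obtain ⟨a, ha⟩ := exists_card_toOrd_eq ht
    exact Set.mem_iUnion.2 ⟨a, htJ, ha.ge⟩
  refine (mk_le_mk_of_subset hsub).trans
    (mk_iUnion_le_of_le hχ (by rwa [mk_ord_toType]) fun a => ?_)
  exact (mk_bounded_subset_le J _).trans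
    ((power_le_power_right (max_le hJ hχ)).trans (hpow _ (card_toOrd_lt a)))

/-- The partial functions of size `< θ` with domain contained in `J`. -/
def smallPartial {X : Type u} (θ : Cardinal.{u}) (J : Set X) : Set (X → Option Bool) :=
  {s | pdom s ⊆ J ∧ #(pdom s) < θ}

theorem mk_smallPartial_le {X : Type u} {θ χ : Cardinal.{u}} (hχ : ℵ₀ ≤ χ) (hθ : θ ≤ χ)
    (hpow : ∀ c < θ, χ ^ c ≤ χ) {J : Set X} (hJ : #J ≤ χ) : #(smallPartial θ J) ≤ χ := by
  let graph : (X → Option Bool) → Set (X × Bool) := fun s => {z | s z.1 = some z.2}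
  have hinj : Function.Injective graph := by
    intro s t h
    funext i
    refine Option.ext fun b => ?_
    exact Set.ext_iff.1 h (i, b)
  have hprod : #(J ×ˢ (Set.univ : Set Bool) : Set (X × Bool)) ≤ χ := by
    rw [(Equiv.Set.prod J Set.univ).cardinal_eq]
    simpa using mul_le_of_le hχ hJ ((natCast_lt_aleph0 (n := 2)).le.trans hχ)
  have himg : graph '' smallPartial θ J ⊆ {t | t ⊆ J ×ˢ Set.univ ∧ #t < θ} := by
    rintro _ ⟨s, ⟨hsJ, hs⟩, rfl⟩
    refine ⟨fun z hz => ⟨hsJ (by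
      have hz : s z.1 = some z.2 := hz
      simp [pdom, hz]), trivial⟩, ?_⟩
    refine (mk_le_of_injective (f := fun z : graph s => (⟨z.1.1, ?_⟩ : pdom s)) ?_).trans_lt hs
    · have : s z.1.1 = some z.1.2 := z.2
      simp [pdom, this]
    · rintro ⟨⟨i, b⟩, hz⟩ ⟨⟨j, b'⟩, hz'⟩ h
      obtain rfl : i = j := congrArg Subtype.val h
      have hz : s i = some b := hz
      have hz' : s i = some b' := hz'
      obtain rfl : b = b' := by simpa [hz] using hz'
      rfl
  rw [← mk_image_eq hinj]
  exact (mk_le_mk_of_subset himg).trans (mk_subsets_lt_le hχ hθ hpow hprod)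

/-- The iteration `J_α = ⋃_{β < α} F (J_β)`. -/
noncomputable def iterUnion {X : Type u} (F : Set X → Set X) (a : Ordinal.{u}) : Set X :=
  ⋃ b : a.ToType, F (iterUnion F (b.toOrd : Ordinal.{u}))
termination_by a
decreasing_by exact b.toOrd.2

theorem mem_iterUnion {X : Type u} {F : Set X → Set X} {a : Ordinal.{u}} {i : X} :
    i ∈ iterUnion F a ↔ ∃ b < a, i ∈ F (iterUnion F b) := by
  rw [iterUnion, Set.mem_iUnion]
  constructor
  · rintro ⟨b, hb⟩
    exact ⟨_, b.toOrd.2, hb⟩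
  · rintro ⟨b, hb, h⟩
    exact ⟨Ordinal.ToType.mk ⟨b, hb⟩, by simpa using h⟩

theorem mk_iterUnion_le {X : Type u} {F : Set X → Set X} {χ : Cardinal.{u}} (hχ : ℵ₀ ≤ χ)
    (hF : ∀ J : Set X, #J ≤ χ → #(F J) ≤ χ) (a : Ordinal.{u}) (ha : a.card ≤ χ) :
    #(iterUnion F a) ≤ χ := by
  induction a using WellFoundedLT.induction with
  | ind a ih =>
    rw [iterUnion]
    refine mk_iUnion_le_of_le hχ (by rwa [mk_toType]) fun b => hF _ (ih b.toOrd b.toOrd.2 ?_)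
    exact (Ordinal.card_le_card b.toOrd.2.le).trans ha

/-- `v` and `w` agree on all fibers of `f` which meet both of their domains. -/
def Agree {X Y : Type u} (f : X → Y) (v w : X → Option Bool) : Prop :=
  ∀ i j k, v j ≠ none → w k ≠ none → f j = f i → f k = f i → v i = w i

theorem Agree.refl {X Y : Type u} (f : X → Y) (v : X → Option Bool) : Agree f v v :=
  fun _ _ _ _ _ _ _ => rfl

theorem Agree.symm {X Y : Type u} {f : X → Y} {v w : X → Option Bool} (h : Agree f v w) :
    Agree f w v :=
  fun i j k hj hk hji hki => (h i k j hk hj hki hji).symm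

/-- The chain condition: a family of partial functions of size `< θ`, no two of which agree on the
fibers (of size `≤ χ`) meeting both domains, has at most `χ = χ^{<θ}` members. -/
theorem mk_le_of_pairwise_not_agree {X Y : Type u} {θ χ : Cardinal.{u}} (hθ : θ.IsRegular)
    (hθχ : θ ≤ χ) (hpow : ∀ c < θ, χ ^ c ≤ χ) (f : X → Y) (hf : ∀ i, #{j | f j = f i} ≤ χ)
    {V : Set (X → Option Bool)} (hsmall : ∀ v ∈ V, #(pdom v) < θ)
    (hV : V.Pairwise fun v w => ¬ Agree f v w) : #V ≤ χ := by
  classical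
  have hχ : ℵ₀ ≤ χ := hθ.aleph0_le.trans hθχ
  -- `E s v`: the member `v` of `V` coincides with `s` on every fiber meeting the domain of `s`; `w
  -- s` picks one such `v`. The aim is a set `J` of size at most `χ` such that every `v ∈ V` is `w`
  -- of its restriction to `J`.
  let E : (X → Option Bool) → (X → Option Bool) → Prop := fun s v =>
    v ∈ V ∧ ∀ i j, s j ≠ none → f j = f i → v i = s i
  let w : (X → Option Bool) → (X → Option Bool) := fun s =>
    if h : ∃ v, E s v then h.choose else fun _ => none
  have hw : ∀ s, (∃ v, E s v) → E s (w s) := fun s h => by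
    simp only [w, dif_pos h]
    exact h.choose_spec
  have hwsmall : ∀ s, #(pdom (w s)) < θ := fun s => by
    by_cases h : ∃ v, E s v
    · exact hsmall _ (hw s h).1
    · have : pdom (w s) = ∅ := by simp [w, dif_neg h, pdom]
      rw [this, mk_eq_zero]
      exact hθ.pos
  -- `F J` collects the fibers met by the chosen `w s`, for small `s` living on `J`; it is iterated
  -- θ times.
  let F : Set X → Set X := fun J =>
    ⋃ s ∈ smallPartial θ J, ⋃ j ∈ pdom (w s), {i | f i = f j}
  have hF : ∀ J : Set X, #J ≤ χ → #(F J) ≤ χ := fun J hJ =>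
    mk_biUnion_le_of_le hχ (mk_smallPartial_le hχ hθχ hpow hJ) fun s _ =>
      mk_biUnion_le_of_le hχ ((hwsmall s).le.trans hθχ) fun j _ => hf j
  have hmemF : ∀ {J i}, i ∈ F J ↔ ∃ s ∈ smallPartial θ J, ∃ j, w s j ≠ none ∧ f i = f j := by
    intro J i
    simp [F, pdom]
  set J := iterUnion F θ.ord with hJdef
  have hJ : #J ≤ χ := mk_iterUnion_le hχ hF _ (by rwa [card_ord])
  have hsat : ∀ i j, i ∈ J → f j = f i → j ∈ J := by
    intro i j hi hij
    obtain ⟨b, hb, hi⟩ := mem_iterUnion.1 hi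
    obtain ⟨s, hs, k, hk, hik⟩ := hmemF.1 hi
    exact mem_iterUnion.2 ⟨b, hb, hmemF.2 ⟨s, hs, k, hk, hij.trans hik⟩⟩
  have hsub : V ⊆ w '' smallPartial θ J := by
    intro v hv
    let s : X → Option Bool := fun i => if i ∈ J then v i else none
    have hsJ : pdom s ⊆ J := fun i hi => by
      by_contra h
      exact hi (if_neg h)
    have hsθ : #(pdom s) < θ := by
      refine (mk_le_mk_of_subset fun i hi => ?_).trans_lt (hsmall v hv)
      have : s i = v i := if_pos (hsJ hi)
      exact fun h => hi (this.trans h)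
    have hex : E s v := ⟨hv, fun i j hj hij => (if_pos (hsat j i (hsJ hj) hij.symm)).symm⟩
    have hws := hw s ⟨v, hex⟩
    refine ⟨s, ⟨hsJ, hsθ⟩, ?_⟩
    by_contra hne
    refine hV hv hws.1 (Ne.symm hne) fun i j k hj hk hji hki => ?_
    -- As θ is regular, `s` already lives on a stage before θ, so the domain of `w s` lies in `J`. A
    -- fiber met by both `v` and `w s` is then contained in `J`, hence met by `s`, where both
    -- coincide with `s`.
    have hch : ∀ i : pdom s, ∃ b < θ.ord, i.1 ∈ F (iterUnion F b) := fun i =>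
      mem_iterUnion.1 (hsJ i.2)
    choose b hb hbi using hch
    have hsup : (⨆ i, succ (b i)) < θ.ord := Ordinal.iSup_lt_of_lt_cof (by rwa [hθ.cof_ord]) fun i =>
      (isSuccLimit_ord hθ.aleph0_le).succ_lt (hb i)
    have hs' : s ∈ smallPartial θ (iterUnion F (⨆ i, succ (b i))) := by
      refine ⟨fun i hi => mem_iterUnion.2 ⟨b ⟨i, hi⟩, ?_, hbi ⟨i, hi⟩⟩, hsθ⟩
      exact (lt_succ _).trans_le (Ordinal.le_iSup (fun i => succ (b i)) _)
    have hkJ : k ∈ J := mem_iterUnion.2 ⟨_, hsup, hmemF.2 ⟨s, hs', k, hk, rfl⟩⟩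
    have hjJ : j ∈ J := hsat k j hkJ (hji.trans hki.symm)
    have hiJ : i ∈ J := hsat k i hkJ hki.symm
    have hsj : s j ≠ none := by
      rwa [show s j = v j from if_pos hjJ]
    rw [hws.2 i j hsj hji]
    exact (if_pos hiJ).symm
  exact (mk_le_mk_of_subset hsub).trans (mk_image_le.trans (mk_smallPartial_le hχ hθχ hpow hJ))

end Cardinals

/-! ### The classes of E_κ, the orders on conditions, and differences. -/

section Conditions

variable {lam mu kap : Cardinal.{u}} {K : Set Cardinal.{u}}

theorem self_mem_cls (k : Cardinal.{u}) (i : Pt mu) : i ∈ cls k i := rfl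

theorem mem_cls_symm {k : Cardinal.{u}} {i j : Pt mu} (h : i ∈ cls k j) : j ∈ cls k i :=
  Eq.symm h

theorem mem_cls_trans {k : Cardinal.{u}} {i j l : Pt mu} (h : i ∈ cls k j) (h' : l ∈ cls k i) :
    l ∈ cls k j :=
  Eq.trans h h'

theorem cls_eq_of_mem {k : Cardinal.{u}} {i j : Pt mu} (h : i ∈ cls k j) : cls k i = cls k j :=
  Set.ext fun _ => ⟨mem_cls_trans h, mem_cls_trans (mem_cls_symm h)⟩

/-- An infinite cardinal is additively indecomposable, so for `k < k'` the ordinal `k'.ord` absorbs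
`k.ord` on the left. -/
theorem cls_mono {k k' : Cardinal.{u}} (hk : ℵ₀ ≤ k') (h : k ≤ k') (i : Pt mu) :
    cls k i ⊆ cls k' i := by
  rcases h.eq_or_lt with rfl | h
  · exact Set.Subset.rfl
  intro j hj
  have hj : (i.toOrd : Ordinal.{u}) + k.ord = j.toOrd + k.ord := hj
  change (i.toOrd : Ordinal.{u}) + k'.ord = j.toOrd + k'.ord
  rw [← (Ordinal.isPrincipal_add_ord hk).add_eq_right (ord_lt_ord.2 h), ← add_assoc, ← add_assoc, hj]

/-- With `m` the least element, every `j` in the class satisfies `m ≤ j < j + k = m + k`, so `j ↦ j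
- m` is an injection into `k`. -/
theorem mk_cls_le {k : Cardinal.{u}} (hk : k ≠ 0) (i : Pt mu) : #(cls k i) ≤ k := by
  obtain ⟨m, hm, hmin⟩ := (wellFounded_lt (α := Pt mu)).has_min (cls k i) ⟨i, self_mem_cls k i⟩
  have hle : ∀ j ∈ cls k i, (m.toOrd : Ordinal.{u}) ≤ j.toOrd := fun j hj => by
    simpa using hmin j hj
  have hlt : ∀ j ∈ cls k i, (j.toOrd : Ordinal.{u}) - m.toOrd < k.ord := fun j hj => by
    have hpos : 0 < k.ord := by simpa [pos_iff_ne_zero] using hk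
    refine Ordinal.sub_lt_of_lt_add ?_ hpos
    have h : (m.toOrd : Ordinal.{u}) + k.ord = j.toOrd + k.ord :=
      mem_cls_trans (mem_cls_symm hm) hj
    rw [h]
    exact lt_add_of_pos_right _ hpos
  let φ : cls k i → k.ord.ToType := fun j => Ordinal.ToType.mk ⟨_, hlt j j.2⟩
  have hφ : Function.Injective φ := fun a b hab => by
    have h := Subtype.mk.inj ((Ordinal.ToType.mk (o := k.ord)).injective hab)
    have h' : (a.1.toOrd : Ordinal.{u}) = b.1.toOrd := by
      rw [← Ordinal.add_sub_cancel_of_le (hle a a.2), h, Ordinal.add_sub_cancel_of_le (hle b b.2)]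
    exact Subtype.ext (Ordinal.ToType.mk.symm.injective (Subtype.ext h'))
  simpa using mk_le_of_injective hφ

theorem Cond.mem_dom {p : Cond lam mu K} {i : Pt mu} : i ∈ p.dom ↔ p.toFun i ≠ none := Iff.rfl

theorem Cond.le_toFun {p q : Cond lam mu K} (h : p ≤ q) {i : Pt mu} (hi : i ∈ p.dom) :
    q.toFun i = p.toFun i := by
  obtain ⟨b, hb⟩ := Option.ne_none_iff_exists'.1 hi
  rw [hb, h.1 i b hb]

/-- One new point witnesses the growth of a class, so growth can be compared point by point. -/
theorem growing_subset {k : Cardinal.{u}} {S T S' T' : Set (Pt mu)} (hST : S ⊆ T)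
    (h : ∀ a ∈ S, ∀ b ∈ cls k a, b ∈ T → b ∉ S → (∃ c ∈ cls k a, c ∈ S') ∧ b ∈ T' ∧ b ∉ S') :
    growing k S T ⊆ growing k S' T' := by
  rintro _ ⟨⟨i, hi, rfl⟩, ⟨a, hai, haS⟩, hne⟩
  refine ⟨⟨i, hi, rfl⟩, ?_⟩
  rw [← cls_eq_of_mem hai] at hne ⊢
  have hex : ∃ b ∈ cls k a, b ∈ T ∧ b ∉ S := by
    by_contra! hcon
    exact hne (Set.ext fun b => ⟨fun hb => ⟨hb.1, hST hb.2⟩, fun hb => ⟨hb.1, hcon b hb.1 hb.2⟩⟩)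
  obtain ⟨b, hb, hbT, hbS⟩ := hex
  obtain ⟨⟨c, hc, hcS⟩, hbT', hbS'⟩ := h a haS b hb hbT hbS
  refine ⟨⟨c, hc, hcS⟩, fun heq => hbS' ?_⟩
  exact (heq.ge ⟨hb, hbT'⟩).2

/-- To verify `p ≤ q`, it suffices to bound the growth by that of an inequality `p' ≤ q'`. -/
theorem Cond.le_of_growth {p q p' q' : Cond lam mu K} (h' : p' ≤ q')
    (hval : ∀ i b, p.toFun i = some b → q.toFun i = some b)
    (h : ∀ k ∈ K, ∀ a ∈ p.dom, ∀ b ∈ cls k a, b ∈ q.dom → b ∉ p.dom →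
      (∃ c ∈ cls k a, c ∈ p'.dom) ∧ b ∈ q'.dom ∧ b ∉ p'.dom) : p ≤ q := by
  refine ⟨hval, fun k hk => (mk_le_mk_of_subset (growing_subset (fun i hi => ?_) (h k hk))).trans_lt
    (h'.2 k hk)⟩
  obtain ⟨b, hb⟩ := Option.ne_none_iff_exists'.1 hi
  exact Option.ne_none_iff_exists'.2 ⟨b, hval i b hb⟩

theorem PureLE.mem_dom {p q : Cond lam mu K} (h : PureLE kap p q) {i j : Pt mu} (hi : i ∈ p.dom)
    (hj : j ∈ cls kap i) (hjq : j ∈ q.dom) : j ∈ p.dom := by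
  by_contra hjp
  refine h.2 _ ⟨i, hi, rfl⟩ ⟨⟨i, self_mem_cls _ _, hi⟩, fun heq => hjp ?_⟩
  exact (heq.ge ⟨hj, hjq⟩).2

theorem PureLE.of_mem_dom {p q : Cond lam mu K} (h : p ≤ q)
    (h' : ∀ i ∈ p.dom, ∀ j ∈ cls kap i, j ∈ q.dom → j ∈ p.dom) : PureLE kap p q := by
  refine ⟨h, ?_⟩
  rintro _ ⟨i, hi, rfl⟩ ⟨-, hne⟩
  exact hne (Set.ext fun j => ⟨fun hj => ⟨hj.1, Cond.dom_mono h hj.2⟩,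
    fun hj => ⟨hj.1, h' i hi j hj.1 hj.2⟩⟩)

theorem PureLE.refl (p : Cond lam mu K) : PureLE kap p p :=
  .of_mem_dom le_rfl fun _ _ _ _ h => h

theorem PureLE.trans {p q r : Cond lam mu K} (h : PureLE kap p q) (h' : PureLE kap q r) :
    PureLE kap p r :=
  .of_mem_dom (h.1.trans h'.1) fun _ hi _ hj hjr =>
    h.mem_dom hi hj (h'.mem_dom (Cond.dom_mono h.1 hi) hj hjr)

theorem ApureLE.exists_mem {q r : Cond lam mu K} (h : ApureLE kap q r) {i : Pt mu}
    (hi : i ∈ r.dom) : ∃ j ∈ q.dom, j ∈ cls kap i := by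
  obtain ⟨j, hj, he⟩ : cls kap i ∈ classes kap q.dom := h.2 ▸ ⟨i, hi, rfl⟩
  exact ⟨j, hj, he ▸ self_mem_cls kap j⟩

theorem ApureLE.of_exists_mem {q r : Cond lam mu K} (h : q ≤ r)
    (h' : ∀ i ∈ r.dom, ∃ j ∈ q.dom, j ∈ cls kap i) : ApureLE kap q r := by
  refine ⟨h, Set.Subset.antisymm ?_ (Set.image_mono (Cond.dom_mono h))⟩
  rintro _ ⟨i, hi, rfl⟩
  obtain ⟨j, hj, hji⟩ := h' i hi
  exact ⟨j, hj, cls_eq_of_mem hji⟩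

/-- The part of `r` outside the domain of `q`. -/
def Cond.diff (q r : Cond lam mu K) : Pt mu → Option Bool :=
  fun i => if q.toFun i = none then r.toFun i else none

theorem Cond.mem_pdom_diff {q r : Cond lam mu K} {i : Pt mu} :
    q.diff r i ≠ none ↔ i ∈ r.dom ∧ i ∉ q.dom := by
  rw [Cond.mem_dom, Cond.mem_dom, Cond.diff]
  split_ifs with h <;> simp [h]

/-- Every new point lies in an E_κ-class that meets `q` and therefore grows. There are fewer than θ
such classes, each meeting `r` in fewer than θ points, and θ is regular. -/
theorem ApureLE.mk_pdom_diff_lt {q r : Cond lam mu K} (h : ApureLE kap q r) (hkap : kap ∈ K) :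
    #(pdom (q.diff r)) < theta lam K kap := by
  have hsub : pdom (q.diff r) ⊆ ⋃ A ∈ growing kap q.dom r.dom, A ∩ r.dom := by
    intro i hi
    obtain ⟨hir, hiq⟩ := Cond.mem_pdom_diff.1 hi
    obtain ⟨j, hj, hji⟩ := h.exists_mem hir
    refine Set.mem_biUnion (x := cls kap i) ⟨⟨i, trivial, rfl⟩, ⟨j, hji, hj⟩, fun heq => hiq ?_⟩
      ⟨self_mem_cls kap i, hir⟩
    exact (heq.ge ⟨self_mem_cls kap i, hir⟩).2
  refine (mk_le_mk_of_subset hsub).trans_lt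
    (mk_biUnion_lt_of_isRegular (theta_isRegular lam K kap) (h.1.2 kap hkap) ?_)
  rintro _ ⟨⟨i, -, rfl⟩, -⟩
  exact r.small i kap hkap

/-- The union of two conditions, the first one taking precedence. -/
def Cond.union (p q : Cond lam mu K) : Cond lam mu K where
  toFun i := (p.toFun i).or (q.toFun i)
  small i k hk := by
    refine (mk_le_mk_of_subset (t := cls k i ∩ p.dom ∪ cls k i ∩ q.dom) ?_).trans_lt
      ((mk_union_le _ _).trans_lt (add_lt_of_lt (theta_isRegular lam K k).aleph0_le
        (p.small i k hk) (q.small i k hk)))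
    rintro j ⟨hj, hjd⟩
    by_cases hp : p.toFun j = none
    · exact Or.inr ⟨hj, by simpa [pdom, Cond.dom, hp] using hjd⟩
    · exact Or.inl ⟨hj, hp⟩

theorem Cond.mem_dom_union {p q : Cond lam mu K} {i : Pt mu} :
    i ∈ (p.union q).dom ↔ i ∈ p.dom ∨ i ∈ q.dom := by
  simp only [Cond.mem_dom, Cond.union]
  cases p.toFun i <;> simp

theorem Cond.union_toFun_left {p q : Cond lam mu K} {i : Pt mu} {b : Bool}
    (h : p.toFun i = some b) : (p.union q).toFun i = some b := by
  simp [Cond.union, h]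

theorem Cond.union_toFun_right {p q : Cond lam mu K}
    (hc : ∀ i, i ∈ p.dom → i ∈ q.dom → p.toFun i = q.toFun i) {i : Pt mu} {b : Bool}
    (h : q.toFun i = some b) : (p.union q).toFun i = some b := by
  by_cases hp : p.toFun i = none
  · simp [Cond.union, h, hp]
  · refine Cond.union_toFun_left ?_
    rw [hc i hp (by simp [Cond.mem_dom, h]), h]

/-! ### Amalgamation, factorization and closure of extensions. -/

section Amalgamation

variable {q q' r : Cond lam mu K}

/-- Apure extensions add points only in E_κ-classes meeting `q`, pure ones only in the other
classes. So `q'` and `r` overlap only on `q`. -/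
theorem PureLE.mem_dom_of_apureLE (hq : PureLE kap q q') (hr : ApureLE kap q r) {i : Pt mu}
    (hi : i ∈ q'.dom) (hir : i ∈ r.dom) : i ∈ q.dom := by
  obtain ⟨j, hj, hji⟩ := hr.exists_mem hir
  exact hq.mem_dom hj (mem_cls_symm hji) hi

theorem PureLE.apureLE_union (hinf : ∀ k ∈ K, ℵ₀ ≤ k) (hkap : kap ∈ K) (hq : PureLE kap q q')
    (hr : ApureLE kap q r) : ApureLE kap q' (q'.union r) := by
  refine .of_exists_mem (Cond.le_of_growth hr.1 (fun _ _ => Cond.union_toFun_left) ?_) ?_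
  · intro k hk a ha b hb hbu hbq'
    have hbr : b ∈ r.dom := (Cond.mem_dom_union.1 hbu).resolve_left hbq'
    refine ⟨?_, hbr, fun hbq => hbq' (Cond.dom_mono hq.1 hbq)⟩
    obtain ⟨j, hj, hjb⟩ := hr.exists_mem hbr
    -- For `k ≤ kap`, the point `a` shares an E_κ-class with `j ∈ q`, so purity places `a` in `q`;
    -- for `k ≥ kap`, the point `j` is itself in the E_k-class of `a`.
    rcases le_total k kap with hle | hle
    · refine ⟨a, self_mem_cls k a, hq.mem_dom hj ?_ ha⟩
      exact mem_cls_trans (mem_cls_symm hjb) (cls_mono (hinf kap hkap) hle b (mem_cls_symm hb))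
    · exact ⟨j, mem_cls_trans hb (cls_mono (hinf k hk) hle b hjb), hj⟩
  · intro i hi
    rcases Cond.mem_dom_union.1 hi with hi | hi
    · exact ⟨i, hi, self_mem_cls _ _⟩
    · obtain ⟨j, hj, hji⟩ := hr.exists_mem hi
      exact ⟨j, Cond.dom_mono hq.1 hj, hji⟩

theorem PureLE.le_union (hinf : ∀ k ∈ K, ℵ₀ ≤ k) (hkap : kap ∈ K) (hq : PureLE kap q q')
    (hr : ApureLE kap q r) : r ≤ q'.union r := by
  refine Cond.le_of_growth hq.1 (fun i b => Cond.union_toFun_right fun i hi hir => ?_) ?_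
  · have hiq := hq.mem_dom_of_apureLE hr hi hir
    rw [Cond.le_toFun hq.1 hiq, Cond.le_toFun hr.1 hiq]
  · intro k hk a ha b hb hbu hbr
    have hbq' : b ∈ q'.dom := (Cond.mem_dom_union.1 hbu).resolve_right hbr
    have hbq : b ∉ q.dom := fun h => hbr (Cond.dom_mono hr.1 h)
    refine ⟨?_, hbq', hbq⟩
    obtain ⟨j, hj, hja⟩ := hr.exists_mem ha
    rcases le_total k kap with hle | hle
    · refine absurd (hq.mem_dom hj ?_ hbq') hbq
      exact mem_cls_trans (mem_cls_symm hja) (cls_mono (hinf kap hkap) hle a hb)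
    · exact ⟨j, cls_mono (hinf k hk) hle a hja, hj⟩

/-- This is why antichains are recorded by differences: the set of differences stays literally the
same while `q` is purely extended. -/
theorem PureLE.diff_union (hq : PureLE kap q q') (hr : ApureLE kap q r) :
    q'.diff (q'.union r) = q.diff r := by
  funext i
  simp only [Cond.diff, Cond.union]
  by_cases hi' : q'.toFun i = none
  · have hi : q.toFun i = none := by
      by_contra h
      exact Cond.dom_mono hq.1 h hi'
    simp [hi, hi']
  · by_cases hi : q.toFun i = none
    · have : r.toFun i = none := by
        by_contra h
        exact hq.mem_dom_of_apureLE hr hi' h hi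
      simp [hi, hi', this]
    · simp [hi, hi']

end Amalgamation

/-- The growth from `r` to `r ∪ s` is bounded by that from `q` to `s`, provided every growing class
meets `q`. For `k ≥ kap` apurity ensures this. For `k < kap` an E_k-class lies inside an E_θ-class;
if it missed `q`, old and new points in it would lie in both differences' common E_θ-class, where
agreement excludes new points. -/
theorem ApureLE.le_union_of_agree {q r s : Cond lam mu K} (hinf : ∀ k ∈ K, ℵ₀ ≤ k)
    (hlow : ∀ k ∈ K, k < kap → k ≤ theta lam K kap)
    (hr : ApureLE kap q r) (hs : ApureLE kap q s)
    (h : Agree (cls (theta lam K kap)) (q.diff r) (q.diff s)) :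
    r ≤ r.union s ∧ s ≤ r.union s := by
  have hdiff : ∀ {t : Cond lam mu K} {i}, i ∉ q.dom → q.diff t i = t.toFun i := fun hi => by
    rw [Cond.diff, if_pos (not_not.1 hi)]
  have hlow' : ∀ {t t' : Cond lam mu K}, ApureLE kap q t →
      Agree (cls (theta lam K kap)) (q.diff t) (q.diff t') → ∀ k ∈ K, ∀ a ∈ t.dom, ∀ b ∈ cls k a,
      b ∈ t'.dom → b ∉ t.dom → ∃ c ∈ cls k a, c ∈ q.dom := by
    intro t t' ht hag k hk a ha b hb hbt' hbt
    rcases lt_or_ge k kap with hlt | hge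
    · by_cases haq : a ∈ q.dom
      · exact ⟨a, self_mem_cls _ _, haq⟩
      by_cases hbq : b ∈ q.dom
      · exact ⟨b, hb, hbq⟩
      have hbθ := cls_mono (theta_isRegular lam K kap).aleph0_le (hlow k hk hlt) a hb
      have := hag b a b (Cond.mem_pdom_diff.2 ⟨ha, haq⟩) (Cond.mem_pdom_diff.2 ⟨hbt', hbq⟩)
        (cls_eq_of_mem hbθ).symm rfl
      rw [hdiff hbq, hdiff hbq, not_not.1 hbt] at this
      exact absurd this.symm hbt'
    · obtain ⟨j, hj, hja⟩ := ht.exists_mem ha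
      exact ⟨j, cls_mono (hinf k hk) hge a hja, hj⟩
  have hcomp : ∀ i, i ∈ r.dom → i ∈ s.dom → r.toFun i = s.toFun i := by
    intro i hir his
    by_cases hiq : i ∈ q.dom
    · rw [Cond.le_toFun hr.1 hiq, Cond.le_toFun hs.1 hiq]
    · rw [← hdiff hiq, ← hdiff hiq]
      exact h i i i (Cond.mem_pdom_diff.2 ⟨hir, hiq⟩) (Cond.mem_pdom_diff.2 ⟨his, hiq⟩) rfl rfl
  constructor
  · refine Cond.le_of_growth hs.1 (fun _ _ => Cond.union_toFun_left) ?_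
    intro k hk a ha b hb hbu hbr
    have hbs := (Cond.mem_dom_union.1 hbu).resolve_left hbr
    exact ⟨hlow' hr h k hk a ha b hb hbs hbr, hbs, fun hbq => hbr (Cond.dom_mono hr.1 hbq)⟩
  · refine Cond.le_of_growth hr.1 (fun _ _ => Cond.union_toFun_right hcomp) ?_
    intro k hk a ha b hb hbu hbs
    have hbr := (Cond.mem_dom_union.1 hbu).resolve_right hbs
    refine ⟨hlow' hs (h.symm) k hk a ha b hb hbr
      hbs, hbr, fun hbq => hbs (Cond.dom_mono hs.1 hbq)⟩

/-- Every extension factors as a pure extension followed by an apure one. -/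
theorem Cond.exists_pureLE_apureLE {q s : Cond lam mu K} (hinf : ∀ k ∈ K, ℵ₀ ≤ k)
    (hkap : kap ∈ K) (h : q ≤ s) : ∃ t, PureLE kap q t ∧ ApureLE kap t s := by
  classical
  -- The intermediate condition is `q` together with the part of `s` on E_κ-classes not meeting `q`.
  let f : Pt mu → Option Bool := fun i =>
    if ∃ j ∈ q.dom, j ∈ cls kap i then q.toFun i else s.toFun i
  have hf1 : ∀ {i}, (∃ j ∈ q.dom, j ∈ cls kap i) → f i = q.toFun i := fun hi => if_pos hi
  have hf2 : ∀ {i}, (¬ ∃ j ∈ q.dom, j ∈ cls kap i) → f i = s.toFun i := fun hi => if_neg hi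
  have hfs : ∀ i b, f i = some b → s.toFun i = some b := by
    intro i b hb
    by_cases hi : ∃ j ∈ q.dom, j ∈ cls kap i
    · exact h.1 i b (hf1 hi ▸ hb)
    · exact hf2 hi ▸ hb
  have hsub : pdom f ⊆ s.dom := fun i hi => by
    obtain ⟨b, hb⟩ := Option.ne_none_iff_exists'.1 hi
    exact Option.ne_none_iff_exists'.2 ⟨b, hfs i b hb⟩
  let t : Cond lam mu K := ⟨f, fun i k hk =>
    (mk_le_mk_of_subset (Set.inter_subset_inter_right _ hsub)).trans_lt (s.small i k hk)⟩
  have hts : t.dom ⊆ s.dom := hsub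
  have hqt : q ≤ t := by
    refine Cond.le_of_growth h (fun i b hb => ?_) fun k _ a ha b _ hbt hbq => ?_
    · have : f i = q.toFun i := hf1 ⟨i, by simp [Cond.mem_dom, hb], self_mem_cls _ _⟩
      exact this.trans hb
    · exact ⟨⟨a, self_mem_cls _ _, ha⟩, hts hbt, hbq⟩
  have ht1 : ∀ {i}, i ∈ t.dom → (∃ j ∈ q.dom, j ∈ cls kap i) → i ∈ q.dom := fun hi hex => by
    have : f _ ≠ none := hi
    rwa [hf1 hex] at this
  have ht2 : ∀ {i}, i ∈ s.dom → i ∉ t.dom → ∃ j ∈ q.dom, j ∈ cls kap i := fun {i} hi hit => by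
    by_contra hex
    have : f i = none := not_not.1 hit
    rw [hf2 hex] at this
    exact hi this
  refine ⟨t, .of_mem_dom hqt fun i hi j hj hjt => ht1 hjt ⟨i, hi, mem_cls_symm hj⟩,
    .of_exists_mem (Cond.le_of_growth h hfs ?_) ?_⟩
  · intro k hk a ha b hb hbs hbt
    refine ⟨?_, hbs, fun hbq => hbt (Cond.dom_mono hqt hbq)⟩
    obtain ⟨j, hj, hjb⟩ := ht2 hbs hbt
    rcases le_total k kap with hle | hle
    · have hba := cls_mono (hinf kap hkap) hle a hb
      exact ⟨a, self_mem_cls _ _, ht1 ha ⟨j, hj, mem_cls_trans hba hjb⟩⟩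
    · exact ⟨j, mem_cls_trans hb (cls_mono (hinf k hk) hle b hjb), hj⟩
  · intro i hi
    by_cases hit : i ∈ t.dom
    · exact ⟨i, hit, self_mem_cls _ _⟩
    · obtain ⟨j, hj, hji⟩ := ht2 hi hit
      exact ⟨j, Cond.dom_mono hqt hj, hji⟩

/-- A nonempty chain of fewer than `κ` conditions under pure extension has an upper bound. -/
theorem PureLE.exists_upperBound (hinf : ∀ k ∈ K, ℵ₀ ≤ k) (hkap : kap ∈ K)
    (hhigh : ∀ k ∈ K, kap < k → kap ≤ theta lam K k) {C : Set (Cond lam mu K)}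
    (hC : #C < kap) (hchain : ∀ c ∈ C, ∀ d ∈ C, PureLE kap c d ∨ PureLE kap d c) :
    ∃ q, ∀ c ∈ C, PureLE kap c q := by
  classical
  let f : Pt mu → Option Bool := fun i =>
    if h : ∃ c ∈ C, i ∈ c.dom then h.choose.toFun i else none
  have hfc : ∀ c ∈ C, ∀ i b, c.toFun i = some b → f i = some b := by
    intro c hc i b hb
    have hex : ∃ c ∈ C, i ∈ c.dom := ⟨c, hc, by simp [Cond.mem_dom, hb]⟩
    have hfi : f i = hex.choose.toFun i := dif_pos hex
    obtain ⟨hd, hid⟩ := hex.choose_spec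
    rw [hfi]
    rcases hchain c hc _ hd with hcd | hdc
    · exact hcd.1.1 i b hb
    · rw [← Cond.le_toFun hdc.1 hid, hb]
  have hfd : ∀ i, i ∈ pdom f → ∃ c ∈ C, i ∈ c.dom := by
    intro i hi
    by_contra hex
    exact hi (dif_neg hex)
  have hmem : ∀ c ∈ C, ∀ i ∈ c.dom, ∀ j ∈ cls kap i, j ∈ pdom f → j ∈ c.dom := by
    intro c hc i hi j hj hjf
    obtain ⟨d, hd, hjd⟩ := hfd j hjf
    rcases hchain c hc d hd with hcd | hdc
    · exact hcd.mem_dom hi hj hjd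
    · exact Cond.dom_mono hdc.1 hjd
  let q : Cond lam mu K := ⟨f, fun i k hk => by
    -- For `k ≤ kap`, once a member of `C` meets an E_k-class, that class no longer changes. For `k
    -- > kap`, `theta lam K k` is regular and larger than the size of `C`, so the union stays small.
    rcases le_or_gt k kap with hle | hlt
    · rcases (cls k i ∩ pdom f).eq_empty_or_nonempty with he | ⟨j, hj, hjf⟩
      · rw [he, mk_eq_zero]
        exact (theta_isRegular lam K k).pos
      · obtain ⟨c, hc, hjc⟩ := hfd j hjf
        refine (mk_le_mk_of_subset ?_).trans_lt (c.small i k hk)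
        rintro l ⟨hl, hlf⟩
        exact ⟨hl, hmem c hc j hjc l (cls_mono (hinf kap hkap) hle j
          (mem_cls_trans (mem_cls_symm hj) hl)) hlf⟩
    · refine (mk_le_mk_of_subset (t := ⋃ c ∈ C, cls k i ∩ pdom c.toFun) ?_).trans_lt
        (mk_biUnion_lt_of_isRegular (theta_isRegular lam K k) (hC.trans_le (hhigh k hk hlt))
          fun c _ => c.small i k hk)
      rintro l ⟨hl, hlf⟩
      obtain ⟨c, hc, hlc⟩ := hfd l hlf
      exact Set.mem_biUnion hc ⟨hl, hlc⟩⟩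
  refine ⟨q, fun c hc => .of_mem_dom ⟨hfc c hc, fun k hk => ?_⟩ (hmem c hc)⟩
  have hsub : growing k c.dom q.dom ⊆ ⋃ d ∈ {d ∈ C | PureLE kap c d}, growing k c.dom d.dom := by
    rintro _ ⟨⟨i, hi, rfl⟩, ⟨a, hai, hac⟩, hne⟩
    have hex : ∃ b ∈ cls k i, b ∈ q.dom ∧ b ∉ c.dom := by
      by_contra! hcon
      refine hne (Set.ext fun b => ⟨fun hb => ⟨hb.1, ?_⟩, fun hb => ⟨hb.1, hcon b hb.1 hb.2⟩⟩)
      obtain ⟨e, he⟩ := Option.ne_none_iff_exists'.1 hb.2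
      exact Option.ne_none_iff_exists'.2 ⟨e, hfc c hc b e he⟩
    obtain ⟨b, hb, hbq, hbc⟩ := hex
    obtain ⟨d, hd, hbd⟩ := hfd b hbq
    rcases hchain c hc d hd with hcd | hdc
    · refine Set.mem_biUnion (x := d) ⟨hd, hcd⟩ ⟨⟨i, hi, rfl⟩, ⟨a, hai, hac⟩, fun heq => hbc ?_⟩
      exact (heq.ge ⟨hb, hbd⟩).2
    · exact absurd (Cond.dom_mono hdc.1 hbd) hbc
  rcases le_or_gt k kap with hle | hlt
  · have : growing k c.dom q.dom ⊆ growing k c.dom c.dom :=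
      growing_subset (fun b hb => by
        obtain ⟨e, he⟩ := Option.ne_none_iff_exists'.1 hb
        exact Option.ne_none_iff_exists'.2 ⟨e, hfc c hc b e he⟩)
        fun a ha b hb hbq hbc =>
          absurd (hmem c hc a ha b (cls_mono (hinf kap hkap) hle a hb) hbq) hbc
    exact (mk_le_mk_of_subset this).trans_lt ((le_refl c).2 k hk)
  · refine (mk_le_mk_of_subset hsub).trans_lt
      (mk_biUnion_lt_of_isRegular (theta_isRegular lam K k) ?_ fun d hd => hd.2.1.2 k hk)
    exact (mk_le_mk_of_subset fun d hd => hd.1).trans_lt (hC.trans_le (hhigh k hk hlt))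

/-- Serves on both sides of a fixed κ: smaller `k ∈ K` satisfy `k ≤ θ_κ`, and larger ones satisfy `κ
≤ θ_k`. -/
theorem le_theta {k : Cardinal.{u}} (hk : k ∈ K) (h : k < kap) : k ≤ theta lam K kap := by
  have hne : {c : Cardinal.{u} | c.IsRegular ∧ sSup ((K ∩ Set.Iio kap) ∪ {lam}) ≤ c}.Nonempty :=
    ⟨succ (max ℵ₀ (sSup ((K ∩ Set.Iio kap) ∪ {lam}))), isRegular_succ (le_max_left _ _),
      (le_max_right _ _).trans (le_succ _)⟩
  refine le_trans (le_csSup ⟨max kap lam, ?_⟩ (Or.inl ⟨hk, h⟩)) (csInf_mem hne).2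
  rintro c (hc | rfl)
  · exact hc.2.le.trans (le_max_left _ _)
  · exact le_max_right _ _

end Conditions

/-! ### Maximal antichains of differences and predense sets. -/

section PurePredense

variable {lam mu kap : Cardinal.{u}} {K : Set Cardinal.{u}}

/-- `V` is a set of differences from `q`, pairwise incompatible, of apure extensions of `q` in `D`,
and `q` is a pure extension of `p`. -/
structure IsApureAntichain (kap : Cardinal.{u}) (D : Set (Cond lam mu K)) (p q : Cond lam mu K)
    (V : Set (Pt mu → Option Bool)) : Prop where
  pure : PureLE kap p q
  exists_apure : ∀ v ∈ V, ∃ r ∈ D, ApureLE kap q r ∧ q.diff r = v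
  pairwise : V.Pairwise fun v w => ¬ Agree (cls (theta lam K kap)) v w

theorem mk_le_two_powerlt_theta {V : Set (Pt mu → Option Bool)}
    (hsmall : ∀ v ∈ V, #(pdom v) < theta lam K kap)
    (hV : V.Pairwise fun v w => ¬ Agree (cls (theta lam K kap)) v w) :
    #V ≤ 2 ^< theta lam K kap := by
  have hθ := theta_isRegular lam K kap
  refine mk_le_of_pairwise_not_agree hθ (le_two_powerlt _) (fun c => two_powerlt_power_le hθ) _
    (fun i => ?_) hsmall hV
  refine (mk_le_mk_of_subset (t := cls (theta lam K kap) i) fun j hj => ?_).trans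
    ((mk_cls_le hθ.ne_zero i).trans (le_two_powerlt _))
  have hj : cls (theta lam K kap) j = cls (theta lam K kap) i := hj
  exact hj ▸ self_mem_cls _ j

theorem IsApureAntichain.mk_pdom_lt {D : Set (Cond lam mu K)} {p q : Cond lam mu K}
    {V : Set (Pt mu → Option Bool)} (h : IsApureAntichain kap D p q V) (hkap : kap ∈ K) :
    ∀ v ∈ V, #(pdom v) < theta lam K kap := by
  intro v hv
  obtain ⟨r, -, hr, rfl⟩ := h.exists_apure v hv
  exact hr.mk_pdom_diff_lt hkap

/-- A set of differences persists under pure extension. -/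
theorem PureLE.exists_apure {D : Set (Cond lam mu K)} (hinf : ∀ k ∈ K, ℵ₀ ≤ k) (hkap : kap ∈ K)
    (hD : ∀ r ∈ D, ∀ s, r ≤ s → s ∈ D) {q q' : Cond lam mu K} (hq : PureLE kap q q')
    {v : Pt mu → Option Bool} (h : ∃ r ∈ D, ApureLE kap q r ∧ q.diff r = v) :
    ∃ r ∈ D, ApureLE kap q' r ∧ q'.diff r = v := by
  obtain ⟨r, hrD, hr, rfl⟩ := h
  exact ⟨q'.union r, hD r hrD _ (hq.le_union hinf hkap hr), hq.apureLE_union hinf hkap hr,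
    hq.diff_union hr⟩

theorem exists_maximal_isApureAntichain {D : Set (Cond lam mu K)} (hinf : ∀ k ∈ K, ℵ₀ ≤ k)
    (hkap : kap ∈ K) (hhigh : ∀ k ∈ K, kap < k → kap ≤ theta lam K k)
    (hpow : 2 ^< theta lam K kap < kap) (hD : ∀ r ∈ D, ∀ s, r ≤ s → s ∈ D) (p : Cond lam mu K) :
    ∃ q V, IsApureAntichain kap D p q V ∧
      ∀ q' V', IsApureAntichain kap D p q' V' → PureLE kap q q' → ¬ V ⊂ V' := by
  let Z := {z : Cond lam mu K × Set (Pt mu → Option Bool) // IsApureAntichain kap D p z.1 z.2}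
  -- Requiring `V` to grow strictly keeps chains short: their cofinality is controlled by the size
  -- of the union of the sets `V`.
  let R : Z → Z → Prop := fun a b => a = b ∨ (PureLE kap a.1.1 b.1.1 ∧ a.1.2 ⊂ b.1.2)
  have hRpure : ∀ {a b}, R a b → PureLE kap a.1.1 b.1.1 := by
    rintro a b (rfl | h)
    exacts [PureLE.refl _, h.1]
  have hRsub : ∀ {a b}, R a b → a.1.2 ⊆ b.1.2 := by
    rintro a b (rfl | h)
    exacts [Set.Subset.rfl, h.2.subset]
  have : Nonempty Z := ⟨⟨(p, ∅), PureLE.refl p, by simp, by simp⟩⟩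
  have hchains : ∀ c : Set Z, IsChain R c → c.Nonempty → ∃ ub, ∀ a ∈ c, R a ub := by
    intro c hc hne
    have htot : ∀ a ∈ c, ∀ b ∈ c, R a b ∨ R b a := fun a ha b hb => by
      by_cases hab : a = b
      · exact Or.inl (Or.inl hab)
      · exact hc ha hb hab
    let W : Set (Pt mu → Option Bool) := ⋃ z ∈ c, z.1.2
    have hW : ∀ z ∈ c, z.1.2 ⊆ W := fun z hz v hv => Set.mem_biUnion hz hv
    by_cases hatt : ∃ z ∈ c, z.1.2 = W
    · obtain ⟨z, hz, hzW⟩ := hatt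
      refine ⟨z, fun a ha => (htot a ha z hz).elim id ?_⟩
      rintro (rfl | h)
      · exact Or.inl rfl
      · exact absurd (hzW ▸ hW a ha) h.2.not_subset
    push Not at hatt
    -- Every member of the chain misses some `v ∈ W`, so it lies below the chosen `g v`. Thus the `g
    -- v` are cofinal, and there are at most `2^{<θ} < kap` of them.
    have hg : ∀ v : W, ∃ z ∈ c, v.1 ∈ z.1.2 := fun v => by
      obtain ⟨z, hz, hv⟩ := Set.mem_iUnion₂.1 v.2
      exact ⟨z, hz, hv⟩
    choose g hgc hgv using hg
    have hWpair : W.Pairwise fun v w => ¬ Agree (cls (theta lam K kap)) v w := by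
      intro v hv w hw hvw
      rcases htot _ (hgc ⟨v, hv⟩) _ (hgc ⟨w, hw⟩) with h | h
      · exact (g ⟨w, hw⟩).2.pairwise (hRsub h (hgv ⟨v, hv⟩)) (hgv ⟨w, hw⟩) hvw
      · exact (g ⟨v, hv⟩).2.pairwise (hgv ⟨v, hv⟩) (hRsub h (hgv ⟨w, hw⟩)) hvw
    have hWcard : #W ≤ 2 ^< theta lam K kap := mk_le_two_powerlt_theta
      (fun v hv => (g ⟨v, hv⟩).2.mk_pdom_lt hkap v (hgv ⟨v, hv⟩)) hWpair
    obtain ⟨q, hq⟩ := PureLE.exists_upperBound (C := Set.range fun v => (g v).1.1) hinf hkap hhigh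
      ((mk_range_le.trans hWcard).trans_lt hpow) (by
        rintro _ ⟨v, rfl⟩ _ ⟨w, rfl⟩
        exact (htot _ (hgc v) _ (hgc w)).imp hRpure hRpure)
    have hgq : ∀ v, PureLE kap (g v).1.1 q := fun v => hq _ ⟨v, rfl⟩
    have hlt : ∀ a ∈ c, PureLE kap a.1.1 q ∧ a.1.2 ⊂ W := by
      intro a ha
      have hss : a.1.2 ⊂ W := (hW a ha).ssubset_of_ne (hatt a ha)
      obtain ⟨v, hv, hva⟩ := Set.exists_of_ssubset hss
      refine ⟨?_, hss⟩
      rcases htot a ha _ (hgc ⟨v, hv⟩) with h | h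
      · exact (hRpure h).trans (hgq _)
      · exact absurd (hRsub h (hgv ⟨v, hv⟩)) hva
    obtain ⟨z, hz⟩ := hne
    refine ⟨⟨(q, W), z.2.pure.trans (hlt z hz).1, fun v hv => ?_, hWpair⟩,
      fun a ha => Or.inr (hlt a ha)⟩
    exact (hgq ⟨v, hv⟩).exists_apure hinf hkap hD ((g ⟨v, hv⟩).2.exists_apure v (hgv ⟨v, hv⟩))
  have htrans : ∀ {a b c : Z}, R a b → R b c → R a c := by
    rintro a b c (rfl | hab) (rfl | hbc)
    · exact Or.inl rfl
    · exact Or.inr hbc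
    · exact Or.inr hab
    · exact Or.inr ⟨hab.1.trans hbc.1, hab.2.trans hbc.2⟩
  obtain ⟨m, hm⟩ := exists_maximal_of_nonempty_chains_bounded (r := R) hchains htrans
  refine ⟨m.1.1, m.1.2, m.2, fun q' V' h hq hV => ?_⟩
  exact hV.not_subset (hRsub (hm ⟨(q', V'), h⟩ (Or.inr ⟨hq, hV⟩)))

/-- A set `D` which is open and dense above `p` has, above some pure extension `q` of `p`, a
predense subset consisting of at most `2^{<θ_κ}` apure extensions of `q`. -/
theorem exists_pureLE_predenseAbove {D : Set (Cond lam mu K)} (hinf : ∀ k ∈ K, ℵ₀ ≤ k)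
    (hkap : kap ∈ K) (hhigh : ∀ k ∈ K, kap < k → kap ≤ theta lam K k)
    (hpow : 2 ^< theta lam K kap < kap) (hD : ∀ r ∈ D, ∀ s, r ≤ s → s ∈ D) {p : Cond lam mu K}
    (hdense : ∀ s, p ≤ s → ∃ t ∈ D, s ≤ t) :
    ∃ (q : Cond lam mu K) (R : Set (Cond lam mu K)), #R ≤ 2 ^< theta lam K kap ∧ PureLE kap p q ∧
      (∀ r ∈ R, r ∈ D ∧ ApureLE kap q r) ∧ PredenseAbove R q := by
  obtain ⟨q, V, hV, hmax⟩ := exists_maximal_isApureAntichain hinf hkap hhigh hpow hD p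
  choose! ρ hρD hρ hρdiff using hV.exists_apure
  refine ⟨q, ρ '' V,
    mk_image_le.trans (mk_le_two_powerlt_theta (hV.mk_pdom_lt hkap) hV.pairwise),
    hV.pure, ?_, fun s hs => ?_⟩
  · rintro _ ⟨v, hv, rfl⟩
    exact ⟨hρD v hv, hρ v hv⟩
  obtain ⟨t, htD, hst⟩ := hdense s (hV.pure.1.trans hs)
  obtain ⟨q', hqq', hq't⟩ := Cond.exists_pureLE_apureLE hinf hkap (hs.trans hst)
  -- If no `v` agrees with `t ∖ q'`, adding this difference to `V` over `q'` contradicts maximality.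
  by_cases hex : ∃ v ∈ V, Agree (cls (theta lam K kap)) v (q'.diff t)
  · obtain ⟨v, hv, hag⟩ := hex
    have hr := hqq'.apureLE_union hinf hkap (hρ v hv)
    have hag' : Agree (cls (theta lam K kap)) (q'.diff (q'.union (ρ v))) (q'.diff t) := by
      rwa [hqq'.diff_union (hρ v hv), hρdiff v hv]
    obtain ⟨h1, h2⟩ := hr.le_union_of_agree hinf (fun k hk hlt => le_theta hk hlt) hq't hag'
    exact ⟨ρ v, ⟨v, hv, rfl⟩, _, (hqq'.le_union hinf hkap (hρ v hv)).trans h1, hst.trans h2⟩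
  · push Not at hex
    have hnot : q'.diff t ∉ V := fun h => hex _ h (Agree.refl _ _)
    refine absurd (Set.ssubset_insert hnot) (hmax q' _ ⟨hV.pure.trans hqq', ?_, ?_⟩ hqq')
    · rintro v (rfl | hv)
      · exact ⟨t, htD, hq't, rfl⟩
      · exact hqq'.exists_apure hinf hkap hD (hV.exists_apure v hv)
    · exact hV.pairwise.insert fun v hv _ => ⟨fun h => hex v hv h.symm, hex v hv⟩

end PurePredense

end PolarizedForcing

theorem mainTheorem3 (lam mu : Cardinal.{u}) (K : Set Cardinal.{u})
    (hlam : lam.IsRegular) (hlam_pow : Cardinal.powerlt lam lam = lam)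
    (hmu : mu.IsRegular) (hmu_pow : mu ^ lam = mu)
    (hK : K ⊆ Set.Icc lam mu) (hK_reg : ∀ kap ∈ K, kap.IsRegular)
    (hlam_mem : lam ∈ K) (hmu_mem : mu ∈ K)
    (kap : Cardinal.{u}) (hkap : kap ∈ K)
    (hkap_pow : Cardinal.powerlt 2 (PolarizedForcing.theta lam K kap) < kap)
    (p : PolarizedForcing.Cond lam mu K)
    (x : PolarizedForcing.PName (PolarizedForcing.Cond lam mu K))
    (hx : PolarizedForcing.ForcesOrdinal p x) :
    ∃ (q : PolarizedForcing.Cond lam mu K) (istar : Ordinal.{u})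
      (r : Set.Iio istar → PolarizedForcing.Cond lam mu K),
      istar < (Order.succ (Cardinal.powerlt 2 (PolarizedForcing.theta lam K kap))).ord ∧
      PolarizedForcing.PureLE kap p q ∧
      (∀ i, PolarizedForcing.ApureLE kap q (r i)) ∧
      (∀ i, PolarizedForcing.Decides (r i) x) ∧
      PolarizedForcing.PredenseAbove (Set.range r) q := by
  obtain ⟨q, R, hR, hpq, hRD, hpre⟩ := PolarizedForcing.exists_pureLE_predenseAbove
    (D := {r | PolarizedForcing.Decides r x}) (fun k hk => (hK_reg k hk).aleph0_le) hkap
    (fun k _ hlt => PolarizedForcing.le_theta hkap hlt) hkap_pow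
    (fun r hr s hrs => PolarizedForcing.Decides.mono hr hrs)
    (fun s hs => (hx.mono hs).exists_decides.imp fun t ht => ⟨ht.2, ht.1⟩)
  obtain ⟨e⟩ : Nonempty ((#R).ord.ToType ≃ R) := Cardinal.eq.1 (mk_ord_toType _)
  let r : Set.Iio (#R).ord → PolarizedForcing.Cond lam mu K := fun i => e (Ordinal.ToType.mk i)
  have hr : Set.range r = R := by
    ext t
    constructor
    · rintro ⟨i, rfl⟩
      exact (e _).2
    · intro ht
      exact ⟨(e.symm ⟨t, ht⟩).toOrd, by simp [r]⟩
  exact ⟨q, (#R).ord, r, ord_lt_ord.2 (lt_succ_of_le hR), hpq, fun i => (hRD _ (e _).2).2,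
    fun i => (hRD _ (e _).2).1, by rwa [hr]⟩
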